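/- Let $(K,v)$ be a henselian valued field (of arbitrary rank), let $\overline K$ be an algebraic closure of $K$ with the unique extension of $v$, again denoted $v$ (written additively), and let $\Omega|K$ be a finite Galois extension inside $\overline K$ with Galois group $\mathcal G=\mathrm{Gal}(\Omega|K)$, valuation ring $\mathcal O_\Omega$ and maximal ideal $\mathcal M_\Omega$. For a subfield $E$ of $\overline K$ containing $K$, write $vE$ and $Ev$ for its value group and residue field; let $p$ be the characteristic exponent of $Kv$. We use the following notions. * A finite extension $E|K$ is *defectless* if $(vE:vK)[Ev:Kv]=[E:K]$. An algebraic extension $F|K$ is *tame* if for every finite subextension $E|K$ the index $(vE:vK)$ is coprime to $p$, $Ev|Kv$ is separable and $E|K$ is defectless; it is *purely wild* if $vF/vK$ is a $p$-group (trivial if $p=1$) and $Fv|Kv$ is purely inseparable. * $K^r$ is the *absolute ramification field*: the fixed field in $K^{\mathrm{sep}}$ of $\{\sigma\in\mathrm{Gal}(\overline K|K) : v(\sigma x-x)>vx \text{ for all } x\in K^{\mathrm{sep}}\setminus\{0\}\}$. * For a subgroup $H\subseteq\mathcal G$ let $\mathcal I_H$ be the ideal of $\mathcal O_\Omega$ generated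 by all $\frac{\sigma z}{z}-1$ with $\sigma\in H$, $z\in\Omega^\times$. A *ramification ideal* of $\Omega|K$ is an ideal $\mathcal I$ with $(0)\subsetneq\mathcal I\subseteq\mathcal M_\Omega$ and $\mathcal I=\mathcal I_H$ for some subgroup $H$ of $\mathcal G$. $\mathrm{Ram}(\Omega|K)$ is the set of all of them. * For a field $F$ with $K\subseteq F\subseteq\overline K$, $S_F(a)=\{v(a-a') : a'\ne a \text{ is an } F\text{-conjugate of } a\}$. * For $a\in\overline K$ and $d<\deg_K(a)$ put $D_d=\{v(z-a) : z\in\overline K,\ \deg_K(z)=d\}$. An *Okutsu sequence* of $a$ over $K$ of length $n$ is a sequence $A_0=\{a\},A_1,\dots,A_n$ of non-empty subsets of $\overline K$, all elements of $A_i$ having the same degree $d_i$ over $K$, such that: $\deg_K(a)=d_0>d_1>\dots>d_n=1$; for $1\le i\le n$ and every $z\in\overline K$ with $\deg_K(z)<d_{i-1}$ there is $z_i\in A_i$ with $v(a-z_i)\ge v(a-z)$; $v(a-z_{i-1})>v(a-z_i)$ for all $z_{i-1}\in A_{i-1}$, $z_i\in A_i$; $A_i$ is a singleton if and only if $\max D_{d_i}$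 exists, in which case $A_i=\{a_i\}$ with $v(a-a_i)=\max D_{d_i}=\max\{v(a-z) : \deg_K(z)<d_{i-1}\}$; and otherwise $A_i=\{z_\nu\}_{\nu<\lambda}$ for a limit ordinal $\lambda$, with $v(a-z_\mu)>v(a-z_\nu)$ for all $\nu<\mu<\lambda$. All Okutsu sequences of $a$ over $K$ have the same length, the *depth* $\ell_K(a)$; $a$ is *pure over $K$* if $\ell_K(a)=1$. The *depth* of $\Omega|K$ is $\min\{\ell_K(a) : K(a)=\Omega\}$. **Theorem.** Assume that $\Omega|K$ is defectless, of depth $1$ and not tame. Then for every $a$ with $K(a)=\Omega$ that is pure over $K$, $$\#\mathrm{Ram}(\Omega|K)=\#S_L(a),\qquad\text{where } L:=\Omega\cap K^r.$$ In particular, if $\Omega|K$ is purely wild, then $\#\mathrm{Ram}(\Omega|K)=\#S_K(a)$. -/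

import Mathlib

open scoped IntermediateField

/-!
Conventions. `K` is a field, `Kbar` an algebraic closure of `K`, and `v` a (Krull) valuation of
`Kbar`, of arbitrary rank, with values in a linearly ordered commutative group with zero; the
valuation of a subfield of `Kbar` is the restriction of `v`. Mathlib writes valuations
multiplicatively: the additive inequality `v x ≥ v y` reads `v x ≤ v y`, the additive value `∞`
reads `0`, and a maximum of additive values is a least element here. Algebraic extensions of `K`
are intermediate fields of `Kbar | K`; `K` itself is the intermediate field `⊥`.
-/

namespace HenselRam

universe u

noncomputable section

variable (K : Type*) {Kbar Γ₀ : Type*} [Field K] [Field Kbar] [Algebra K Kbar]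
  [LinearOrderedCommGroupWithZero Γ₀]

/-- `(K, v)` is henselian: up to equivalence, `v` is the only extension to the algebraic closure
`Kbar` of its restriction to `K` (valuations up to equivalence are valuation rings). -/
def IsHenselianValued (v : Valuation Kbar Γ₀) : Prop :=
  ∀ B : ValuationSubring Kbar,
    B.comap (algebraMap K Kbar) = v.valuationSubring.comap (algebraMap K Kbar) →
      B = v.valuationSubring

variable {K}

/-- The value group `vE` of an intermediate field `E`, as a subgroup of `Γ₀ˣ`. -/
def valueGrp (v : Valuation Kbar Γ₀) (E : IntermediateField K Kbar) : Subgroup Γ₀ˣ where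
  carrier := {γ | ∃ x ∈ E, v x = γ}
  one_mem' := ⟨1, E.one_mem, by simp⟩
  mul_mem' := by
    rintro _ _ ⟨x, hx, h⟩ ⟨y, hy, h'⟩
    exact ⟨x * y, E.mul_mem hx hy, by simp [h, h']⟩
  inv_mem' := by
    rintro _ ⟨x, hx, h⟩
    exact ⟨x⁻¹, E.inv_mem hx, by simp [h]⟩

/-- The residue field `Ev` of an intermediate field `E`, as a subfield of the residue field of
`Kbar`: all residues of elements of `E` that are integral for `v`. -/
def resField (v : Valuation Kbar Γ₀) (E : IntermediateField K Kbar) :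
    Subfield (IsLocalRing.ResidueField v.valuationSubring) where
  toSubring := (E.toSubring.comap v.valuationSubring.subtype).map
    (IsLocalRing.residue v.valuationSubring)
  inv_mem' := by
    rintro _ ⟨x, hx, rfl⟩
    by_cases h : IsUnit x
    · obtain ⟨u, rfl⟩ := h
      refine ⟨((u⁻¹ : (v.valuationSubring)ˣ) : v.valuationSubring), ?_, ?_⟩
      · have h1 : ((((u⁻¹ : (v.valuationSubring)ˣ) : v.valuationSubring)) : Kbar)
            = (((u : v.valuationSubring)) : Kbar)⁻¹ := by
          apply eq_inv_of_mul_eq_one_left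
          rw [← MulMemClass.coe_mul, u.inv_mul]
          rfl
        change ((((u⁻¹ : (v.valuationSubring)ˣ) : v.valuationSubring)) : Kbar) ∈ E
        rw [h1]
        exact E.inv_mem hx
      · apply eq_inv_of_mul_eq_one_left
        rw [← map_mul, u.inv_mul, map_one]
    · have h0 : IsLocalRing.residue v.valuationSubring x = 0 := by
        rwa [IsLocalRing.residue_eq_zero_iff, IsLocalRing.mem_maximalIdeal]
      refine ⟨0, E.zero_mem, ?_⟩
      rw [h0, map_zero, inv_zero]

variable (K) in
/-- The characteristic exponent `p` of the residue field `Kv`. -/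
def charExponent (v : Valuation Kbar Γ₀) : ℕ :=
  ringExpChar (resField v (⊥ : IntermediateField K Kbar))

/-- The ramification index `(vE : vK)`. -/
def ramIndex (v : Valuation Kbar Γ₀) (E : IntermediateField K Kbar) : ℕ :=
  (valueGrp v (⊥ : IntermediateField K Kbar)).relIndex (valueGrp v E)

/-- The inertia degree `[Ev : Kv]`. -/
def inertiaDegree (v : Valuation Kbar Γ₀) (E : IntermediateField K Kbar) : ℕ :=
  Subfield.relfinrank (resField v (⊥ : IntermediateField K Kbar)) (resField v E)

/-- The finite extension `E | K` is defectless: `(vE : vK) [Ev : Kv] = [E : K]`. -/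
def IsDefectless (v : Valuation Kbar Γ₀) (E : IntermediateField K Kbar) : Prop :=
  ramIndex v E * inertiaDegree v E = Module.finrank K E

/-- The extension `F | K` is tame: for every finite subextension `E | K`, the ramification index is
coprime to `p`, the residue field extension is separable, and `E | K` is defectless. -/
def IsTame (v : Valuation Kbar Γ₀) (F : IntermediateField K Kbar) : Prop :=
  ∀ E : IntermediateField K Kbar, E ≤ F → FiniteDimensional K E →
    Nat.Coprime (ramIndex v E) (charExponent K v) ∧
    (∀ x ∈ resField v E, IsSeparable (resField v (⊥ : IntermediateField K Kbar)) x) ∧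
    IsDefectless v E

/-- The extension `F | K` is purely wild: `vF / vK` is a `p`-group and `Fv | Kv` is purely
inseparable, where `p` is the characteristic exponent of `Kv`. -/
def IsPurelyWild (v : Valuation Kbar Γ₀) (F : IntermediateField K Kbar) : Prop :=
  (∀ γ ∈ valueGrp v F, ∃ n : ℕ,
    γ ^ (charExponent K v ^ n) ∈ valueGrp v (⊥ : IntermediateField K Kbar)) ∧
  (∀ x ∈ resField v F, ∃ n : ℕ,
    x ^ (charExponent K v ^ n) ∈ resField v (⊥ : IntermediateField K Kbar))

variable (K) in
/-- The absolute ramification group `G^r` of `(K, v)`: all `σ` in `Gal (Kbar | K)` with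
`v (σ a - a) > v a` (additively) for every nonzero `a` in the separable closure of `K`. -/
def absRamGroup (v : Valuation Kbar Γ₀) : Set (Kbar ≃ₐ[K] Kbar) :=
  {σ | ∀ a ∈ separableClosure K Kbar, a ≠ 0 → v (σ a - a) < v a}

variable (K) in
/-- The absolute ramification field `K^r`: the fixed field of `G^r` in the separable closure. -/
def absRamField (v : Valuation Kbar Γ₀) : IntermediateField K Kbar where
  carrier := {x | x ∈ separableClosure K Kbar ∧ ∀ σ ∈ absRamGroup K v, σ x = x}
  mul_mem' := fun hx hy =>
    ⟨mul_mem hx.1 hy.1, fun σ hσ => by rw [map_mul, hx.2 σ hσ, hy.2 σ hσ]⟩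
  add_mem' := fun hx hy =>
    ⟨add_mem hx.1 hy.1, fun σ hσ => by rw [map_add, hx.2 σ hσ, hy.2 σ hσ]⟩
  algebraMap_mem' := fun r => ⟨algebraMap_mem _ r, fun σ _ => σ.commutes r⟩
  inv_mem' := fun _ hx => ⟨inv_mem hx.1, fun σ hσ => by rw [map_inv₀, hx.2 σ hσ]⟩

variable (K) in
/-- The degree `deg_K z` of an algebraic element. -/
def deg (z : Kbar) : ℕ := (minpoly K z).natDegree

variable (K) in
/-- `D_d (a, K)`, the set of all values `v (z - a)` with `deg_K z = d`. -/
def distSet (v : Valuation Kbar Γ₀) (a : Kbar) (d : ℕ) : Set Γ₀ :=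
  {γ | ∃ z : Kbar, deg K z = d ∧ v (z - a) = γ}

variable (K) in
/-- `A 0, …, A n` is an Okutsu sequence of `a` over `K`, of length `n`, where `d i` is the common
degree over `K` of the elements of `A i`. -/
structure IsOkutsuSeq {Kbar : Type u} [Field Kbar] [Algebra K Kbar] (v : Valuation Kbar Γ₀)
    (a : Kbar) (n : ℕ) (A : Fin (n + 1) → Set Kbar) (d : Fin (n + 1) → ℕ) : Prop where
  zero_eq : A 0 = {a}
  nonempty : ∀ i, (A i).Nonempty
  deg_eq : ∀ i, ∀ z ∈ A i, deg K z = d i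
  deg_strictAnti : StrictAnti d
  deg_last : d (Fin.last n) = 1
  approx : ∀ i : Fin n, ∀ z : Kbar, deg K z < d i.castSucc → ∃ z' ∈ A i.succ,
    v (a - z') ≤ v (a - z)
  closer : ∀ i : Fin n, ∀ z' ∈ A i.succ, ∀ z ∈ A i.castSucc, v (a - z) < v (a - z')
  /-- `A i` is a singleton if and only if `max D_{d i}` exists. -/
  singleton_iff : ∀ i : Fin n,
    (∃ z, A i.succ = {z}) ↔ ∃ γ, IsLeast (distSet K v a (d i.succ)) γ
  /-- In this case the value of its distance from `a` is that maximum, and also the maximum of the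
  values over all elements of degree less than `d (i - 1)`. -/
  singleton_max : ∀ (i : Fin n) (z : Kbar), A i.succ = {z} →
    IsLeast (distSet K v a (d i.succ)) (v (a - z)) ∧
    IsLeast {γ | ∃ y : Kbar, deg K y < d i.castSucc ∧ v (a - y) = γ} (v (a - z))
  /-- Otherwise `A i` is a family indexed by the ordinals below a limit ordinal, with strictly
  increasing (additive) values of the distance from `a`. -/
  limit : ∀ i : Fin n, (¬ ∃ γ, IsLeast (distSet K v a (d i.succ)) γ) →
    ∃ (l : Ordinal.{u}) (z : Ordinal.{u} → Kbar), Order.IsSuccLimit l ∧ A i.succ = z '' Set.Iio l ∧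
      ∀ ν μ, ν < μ → μ < l → v (a - z μ) < v (a - z ν)

variable (K) in
/-- The depth `ℓ_K a`: the length of the Okutsu sequences of `a` over `K`. (All of them have the
same length; the infimum is just a way to name it, with value `⊤` if there were none.) -/
def depth (v : Valuation Kbar Γ₀) (a : Kbar) : ℕ∞ :=
  ⨅ (n : ℕ) (_ : ∃ A d, IsOkutsuSeq K v a n A d), (n : ℕ∞)

variable (K) in
/-- `a` is pure over `K`: its depth is one. -/
def IsPure (v : Valuation Kbar Γ₀) (a : Kbar) : Prop := depth K v a = 1

/-- The depth of the extension `F | K`: the minimum of the depths of its generators. -/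
def extDepth (v : Valuation Kbar Γ₀) (F : IntermediateField K Kbar) : ℕ∞ :=
  ⨅ (a : Kbar) (_ : K⟮a⟯ = F), depth K v a

/-- `S_F a`, the set of all values `v (a - a')` for `F`-conjugates `a' ≠ a` of `a`. -/
def conjValues (F : Type*) [Field F] [Algebra F Kbar] (v : Valuation Kbar Γ₀) (a : Kbar) :
    Set Γ₀ :=
  {γ | ∃ a' : Kbar, a' ≠ a ∧ IsConjRoot F a a' ∧ v (a - a') = γ}

/-- The valuation ring `𝒪_E` of an intermediate field `E`. -/
abbrev valRing (v : Valuation Kbar Γ₀) (E : IntermediateField K Kbar) : ValuationSubring E :=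
  (v.comap (algebraMap E Kbar)).valuationSubring

/-- The ideal `I_H` of `𝒪_E` generated by all `σ z / z - 1` with `σ ∈ H` and `z ∈ E^×`. (For
henselian `K` all these elements lie in `𝒪_E`.) -/
def ramIdeal (v : Valuation Kbar Γ₀) (E : IntermediateField K Kbar) (H : Subgroup (E ≃ₐ[K] E)) :
    Ideal (valRing v E) :=
  Ideal.span {y | ∃ σ ∈ H, ∃ z : E, z ≠ 0 ∧ (y : E) = σ z / z - 1}

/-- `Ram (E | K)`: the set of ramification ideals, i.e. of the nonzero ideals of `𝒪_E` that are
contained in its maximal ideal and equal `I_H` for some subgroup `H` of `Gal (E | K)`. -/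
def Ram (v : Valuation Kbar Γ₀) (E : IntermediateField K Kbar) : Set (Ideal (valRing v E)) :=
  {I | I ≠ ⊥ ∧ I ≤ IsLocalRing.maximalIdeal (valRing v E) ∧
    ∃ H : Subgroup (E ≃ₐ[K] E), I = ramIdeal v E H}

end

end HenselRam

/-! A pure generator `a` of a defectless extension has a best approximation `c` in `K`: otherwise
elements of `K` would come arbitrarily close, `K(a) | K` would be immediate, and its degree would be
one. Put `b = a - c`. Each `z` in `K(a)` is `f(a)` with `deg f < deg a`. Factoring `f` over the
algebraic closure writes `σ z / z` as a product of factors `(σ a - r) / (a - r)`, and each differs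
from `1` by at most `σ b / b` does, because no root `r` is closer to `a` than `c`. So `I_H` is
principal, generated by `σ b / b - 1` for the `σ` in `H` that moves `a` most. Ramification ideals
therefore correspond to the values `v (σ a - a)`, with `σ` in the ramification group of `Ω | K` and
`σ a ≠ a` (`ram_encard_eq`). These values form `S_L(a)` because `Gal(Kbar | L)` induces on `Ω`
exactly that ramification group (`fixing_inf_absRamField_iff`). The hard half is that the absolute
ramification group surjects onto it (`exists_mem_absRamGroup_eqOn`): lift to the inertia group,
remove the prime-to-`p` part by taking a power, and pass to the limit by compactness. In the purely
wild case every automorphism lies in the ramification group, so `K` can replace `L`. -/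

namespace HenselRam

open Polynomial

/-! ### Invariance of the valuation under automorphisms. -/

section Invariance

variable {K Kbar Γ₀ : Type*} [Field K] [Field Kbar] [Algebra K Kbar]
  [LinearOrderedCommGroupWithZero Γ₀] {v : Valuation Kbar Γ₀}

theorem IsHenselianValued.algEquiv_le_one_iff (hens : IsHenselianValued K v) (σ : Kbar ≃ₐ[K] Kbar)
    (x : Kbar) : v (σ x) ≤ 1 ↔ v x ≤ 1 := by
  have h := hens (v.valuationSubring.comap (σ : Kbar →+* Kbar)) (by
    ext y
    simp [ValuationSubring.mem_comap])
  have := congrArg (x ∈ ·) h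
  simpa [ValuationSubring.mem_comap] using this

theorem IsHenselianValued.algEquiv_lt_iff (hens : IsHenselianValued K v) (σ : Kbar ≃ₐ[K] Kbar)
    (x y : Kbar) : v (σ x) < v (σ y) ↔ v x < v y := by
  by_cases hx : x = 0
  · simp [hx, zero_lt_iff]
  have hx' : 0 < v x := zero_lt_iff.2 (by simpa using hx)
  have hx'' : 0 < v (σ x) := zero_lt_iff.2 (by simpa using hx)
  have := hens.algEquiv_le_one_iff σ (y / x)
  rw [map_div₀, map_div₀, map_div₀, div_le_one₀ hx', div_le_one₀ hx''] at this
  simpa using not_congr this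

/-- Uniqueness of the valuation ring only says that `σ` preserves the order of values. That it fixes
them uses finiteness of conjugates: if `v (σ x) < v x`, the `σ ^ n x` would be infinitely many roots
of one polynomial. -/
theorem IsHenselianValued.le_algEquiv [Algebra.IsAlgebraic K Kbar] (hens : IsHenselianValued K v)
    (σ : Kbar ≃ₐ[K] Kbar) (x : Kbar) : v x ≤ v (σ x) := by
  by_contra! h
  have hanti : StrictAnti fun n : ℕ => v ((σ ^ n) x) := by
    refine strictAnti_nat_of_succ_lt fun n => ?_
    rw [pow_succ]
    exact (hens.algEquiv_lt_iff (σ ^ n) (σ x) x).2 h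
  have hinj : Function.Injective fun n : ℕ => (σ ^ n) x :=
    fun m n hmn => hanti.injective (congrArg v hmn)
  have hfin : ((minpoly K x).rootSet Kbar).Finite := rootSet_finite _ _
  refine Set.infinite_of_injective_forall_mem hinj (fun n => ?_) hfin
  rw [mem_rootSet]
  refine ⟨minpoly.ne_zero (Algebra.IsIntegral.isIntegral x), ?_⟩
  rw [aeval_algHom_apply, minpoly.aeval, map_zero]

theorem IsHenselianValued.algEquiv_eq [Algebra.IsAlgebraic K Kbar] (hens : IsHenselianValued K v)
    (σ : Kbar ≃ₐ[K] Kbar) (x : Kbar) : v (σ x) = v x :=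
  le_antisymm (by simpa using hens.le_algEquiv σ.symm (σ x)) (hens.le_algEquiv σ x)

end Invariance

/-! ### Products of elements close to `1`. -/

section Products

variable {F Γ₀ : Type*} [Field F] [LinearOrderedCommGroupWithZero Γ₀] (v : Valuation F Γ₀)

theorem mem_maximalIdeal_iff_lt_one (x : v.valuationSubring) :
    x ∈ IsLocalRing.maximalIdeal v.valuationSubring ↔ v x < 1 := by
  rw [ValuationSubring.valuation_lt_one_iff]
  exact v.isEquiv_valuation_valuationSubring.symm.lt_one_iff_lt_one

theorem map_multiset_prod_sub_one_le {γ : Γ₀} (hγ : γ ≤ 1) (s : Multiset F)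
    (h : ∀ x ∈ s, v (x - 1) ≤ γ) : v (s.prod - 1) ≤ γ ∧ v s.prod ≤ 1 := by
  have aux : ∀ y : F, v (y - 1) ≤ γ → v y ≤ 1 := fun y hy => by
    have := v.map_add_le (x := y - 1) (y := 1) (g := 1) (hy.trans hγ) (by simp)
    simpa using this
  suffices v (s.prod - 1) ≤ γ from ⟨this, aux _ this⟩
  induction s using Multiset.induction with
  | empty => simp
  | cons x s ih =>
    have hs := ih fun y hy => h y (Multiset.mem_cons_of_mem hy)
    have hx := h x (Multiset.mem_cons_self x s)
    rw [Multiset.prod_cons, show x * s.prod - 1 = x * (s.prod - 1) + (x - 1) by ring]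
    refine v.map_add_le ?_ hx
    rw [map_mul]
    exact (mul_le_mul' (aux x hx) hs).trans_eq (one_mul _)

theorem map_multiset_prod_sub_one_lt (s : Multiset F)
    (h : ∀ x ∈ s, v (x - 1) < 1) : v (s.prod - 1) < 1 := by
  have aux : ∀ y : F, v (y - 1) < 1 → v y ≤ 1 := fun y hy => by
    have := v.map_add_le (x := y - 1) (y := 1) (g := 1) hy.le (by simp)
    simpa using this
  induction s using Multiset.induction with
  | empty => simp
  | cons x s ih =>
    have hs := ih fun y hy => h y (Multiset.mem_cons_of_mem hy)
    have hx := h x (Multiset.mem_cons_self x s)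
    rw [Multiset.prod_cons, show x * s.prod - 1 = x * (s.prod - 1) + (x - 1) by ring]
    refine v.map_add_lt ?_ hx
    rw [map_mul]
    exact (mul_le_mul' (aux x hx) le_rfl).trans_lt (by rwa [one_mul])

end Products

/-! ### Okutsu sequences of length one. -/

section Pure

variable {K Kbar Γ₀ : Type*} [Field K] [Field Kbar] [Algebra K Kbar]
  [LinearOrderedCommGroupWithZero Γ₀] {v : Valuation Kbar Γ₀}

theorem IsPure.exists_isOkutsuSeq {a : Kbar} (h : IsPure K v a) :
    ∃ A d, IsOkutsuSeq K v a 1 A d := by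
  unfold IsPure depth at h
  have h1 : (⨅ (n : ℕ) (_ : ∃ A d, IsOkutsuSeq K v a n A d), (n : ℕ∞)) < 2 := by
    rw [h]; norm_num
  simp only [iInf_lt_iff] at h1
  obtain ⟨n, hn, hlt⟩ := h1
  have hge : (1 : ℕ∞) ≤ n := by
    rw [← h]
    exact iInf₂_le n hn
  have h2 : n = 1 := by
    have hlt' : n < 2 := by exact_mod_cast hlt
    have hge' : 1 ≤ n := by exact_mod_cast hge
    omega
  exact h2 ▸ hn

theorem deg_eq_one_iff [Algebra.IsAlgebraic K Kbar] (z : Kbar) :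
    deg K z = 1 ↔ ∃ c : K, algebraMap K Kbar c = z := by
  rw [deg, minpoly.natDegree_eq_one_iff]
  exact Iff.rfl

/-- A pure element is approximated by the base field at least as well as by any
element of smaller degree; either a best approximation exists or there are arbitrarily good ones. -/
theorem IsPure.exists_best_or [Algebra.IsAlgebraic K Kbar] {a : Kbar} (h : IsPure K v a) :
    1 < deg K a ∧
      ((∃ c : K, ∀ z : Kbar, deg K z < deg K a → v (a - algebraMap K Kbar c) ≤ v (a - z)) ∨
        ∀ z : Kbar, deg K z < deg K a → ∃ c : K, v (a - algebraMap K Kbar c) < v (a - z)) := by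
  obtain ⟨A, d, hA⟩ := h.exists_isOkutsuSeq
  have hd0 : deg K a = d 0 := hA.deg_eq 0 a (by rw [hA.zero_eq]; rfl)
  have hd1 : d 1 = 1 := hA.deg_last
  have hlt : d 1 < d 0 := hA.deg_strictAnti (by decide)
  refine ⟨by omega, ?_⟩
  by_cases hmax : ∃ γ, IsLeast (distSet K v a (d (Fin.succ 0))) γ
  · left
    obtain ⟨z, hz⟩ := (hA.singleton_iff 0).2 hmax
    obtain ⟨c, rfl⟩ := (deg_eq_one_iff z).1
      ((hA.deg_eq _ z (show z ∈ A (Fin.succ 0) by rw [hz]; rfl)).trans hd1)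
    refine ⟨c, fun y hy => ?_⟩
    exact (hA.singleton_max 0 _ hz).2.2 ⟨y, by rwa [hd0] at hy, rfl⟩
  · right
    intro z hz
    obtain ⟨z', hz', hle⟩ := hA.approx 0 z (by rwa [hd0] at hz)
    have hdz' : deg K z' = 1 := (hA.deg_eq _ z' hz').trans hd1
    -- No element of `K` is closest to `a`, so some element of `K` is strictly closer than `z'`.
    have : ¬ v (z' - a) ∈ lowerBounds (distSet K v a (d (Fin.succ 0))) := fun hl =>
      hmax ⟨_, ⟨z', hdz'.trans hd1.symm, rfl⟩, hl⟩
    simp only [lowerBounds, Set.mem_ofPred_eq, not_forall, not_le] at this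
    obtain ⟨γ, ⟨y, hy, rfl⟩, hγ⟩ := this
    obtain ⟨c, rfl⟩ := (deg_eq_one_iff y).1 (hy.trans hd1)
    refine ⟨c, ?_⟩
    rw [v.map_sub_swap a]
    rw [v.map_sub_swap z'] at hγ
    exact hγ.trans_le hle

end Pure

/-! ### Best approximation of a pure generator. -/

section Generator

variable {K Kbar Γ₀ : Type*} [Field K] [Field Kbar] [Algebra K Kbar]
  [LinearOrderedCommGroupWithZero Γ₀] {v : Valuation Kbar Γ₀}

theorem exists_aeval_eq_of_mem_adjoin [Algebra.IsAlgebraic K Kbar] {a z : Kbar} (hz : z ∈ K⟮a⟯) :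
    ∃ f : K[X], f.natDegree < deg K a ∧ aeval a f = z := by
  have ha : IsIntegral K a := Algebra.IsIntegral.isIntegral a
  rw [← IntermediateField.mem_toSubalgebra,
    IntermediateField.adjoin_simple_toSubalgebra_of_isAlgebraic ha.isAlgebraic,
    Algebra.adjoin_singleton_eq_range_aeval] at hz
  obtain ⟨g, rfl⟩ := hz
  refine ⟨g %ₘ minpoly K a, natDegree_modByMonic_lt _ (minpoly.monic ha) (minpoly.ne_one K a), ?_⟩
  exact aeval_modByMonic_eq_self_of_root (minpoly.aeval K a)

/-- The point `y` is left free: it is a conjugate of `a` when `σ z / z` is estimated, and an element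
of `K` when `z` is approximated from `K`. -/
theorem exists_aeval_div_aeval_eq_prod [IsAlgClosed Kbar] (f : K[X]) (a : Kbar)
    (hf : aeval a f ≠ 0) :
    ∃ s : Multiset Kbar, (∀ r ∈ s, a - r ≠ 0 ∧ deg K r ≤ f.natDegree) ∧
      ∀ y : Kbar, aeval y f / aeval a f = (s.map fun r => (y - r) / (a - r)).prod := by
  have hf0 : f ≠ 0 := by rintro rfl; simp at hf
  have hsplit : ∀ y : Kbar, aeval y f = algebraMap K Kbar f.leadingCoeff *
      ((f.aroots Kbar).map fun r => y - r).prod := fun y => by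
    have h := (IsAlgClosed.splits (f.map (algebraMap K Kbar))).eq_prod_roots
    have h' := congrArg (eval y) h
    rw [eval_map_algebraMap, eval_mul, eval_C, eval_multiset_prod, Multiset.map_map,
      leadingCoeff_map] at h'
    simpa [aroots] using h'
  refine ⟨f.aroots Kbar, fun r hr => ⟨?_, ?_⟩, fun y => ?_⟩
  · intro h
    rw [mem_aroots, ← sub_eq_zero.1 h] at hr
    exact hf hr.2
  · rw [mem_aroots] at hr
    exact natDegree_le_of_dvd (minpoly.dvd K r hr.2) hf0
  · rw [Multiset.prod_map_div, hsplit y, hsplit a, mul_div_mul_left]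
    simpa using hf0

/-- If `c` is a best approximation of `a` among all elements of smaller degree, then the quotients
`σ z / z` for `z ∈ K(a)` are at most as far from `1` as `σ b / b` for `b = a - c`. -/
theorem map_algEquiv_div_sub_one_le [IsAlgClosed Kbar] [Algebra.IsAlgebraic K Kbar]
    (hinv : ∀ (σ : Kbar ≃ₐ[K] Kbar) (x : Kbar), v (σ x) = v x) {a : Kbar} {c : K}
    (hc : ∀ z : Kbar, deg K z < deg K a → v (a - algebraMap K Kbar c) ≤ v (a - z))
    (hac : a - algebraMap K Kbar c ≠ 0) (σ : Kbar ≃ₐ[K] Kbar) {z : Kbar} (hz : z ∈ K⟮a⟯)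
    (hz0 : z ≠ 0) : v (σ z / z - 1) ≤ v (σ a - a) / v (a - algebraMap K Kbar c) := by
  obtain ⟨f, hfdeg, rfl⟩ := exists_aeval_eq_of_mem_adjoin hz
  obtain ⟨s, hs, hprod⟩ := exists_aeval_div_aeval_eq_prod f a hz0
  have hpos : 0 < v (a - algebraMap K Kbar c) := zero_lt_iff.2 (v.ne_zero_iff.2 hac)
  rw [← aeval_algHom_apply, hprod]
  refine (map_multiset_prod_sub_one_le v ?_ _ ?_).1
  -- The bound is at most `1` since `a - c` and its conjugate have the same value.
  · rw [div_le_one₀ hpos, show σ a - a = σ (a - algebraMap K Kbar c) - (a - algebraMap K Kbar c) by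
      rw [map_sub, σ.commutes]; ring]
    exact v.map_sub_le (hinv _ _).le le_rfl
  · intro x hx
    obtain ⟨r, hr, rfl⟩ := Multiset.mem_map.1 hx
    obtain ⟨har, hdeg⟩ := hs r hr
    rw [show (σ a - r) / (a - r) - 1 = (σ a - a) / (a - r) by field_simp; ring, map_div₀]
    exact div_le_div_of_nonneg_left zero_le hpos (hc r (hdeg.trans_lt hfdeg))

/-- If `a` has arbitrarily good approximations in `K`, then `K(a) | K` is immediate. -/
theorem exists_sub_algebraMap_lt_of_approx [IsAlgClosed Kbar] [Algebra.IsAlgebraic K Kbar]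
    {a : Kbar} (h : ∀ z : Kbar, deg K z < deg K a → ∃ c : K, v (a - algebraMap K Kbar c) < v (a - z))
    {z : Kbar} (hz : z ∈ K⟮a⟯) (hz0 : z ≠ 0) :
    ∃ c : K, v (algebraMap K Kbar c - z) < v z := by
  obtain ⟨f, hfdeg, rfl⟩ := exists_aeval_eq_of_mem_adjoin hz
  obtain ⟨s, hs, hprod⟩ := exists_aeval_div_aeval_eq_prod f a hz0
  -- Take `c` closer to `a` than all the finitely many roots of `f`; then `f(c) / f(a)` is a product
  -- of factors close to `1`.
  have key : ∃ c : K, ∀ r ∈ s, v (a - algebraMap K Kbar c) < v (a - r) := by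
    have hs' : ∀ r ∈ s, deg K r < deg K a := fun r hr => (hs r hr).2.trans_lt hfdeg
    clear hs hprod
    induction s using Multiset.induction with
    | empty => exact ⟨0, by simp⟩
    | cons x s ih =>
      obtain ⟨c, hc⟩ := ih fun r hr => hs' r (Multiset.mem_cons_of_mem hr)
      obtain ⟨c', hc'⟩ := h x (hs' x (Multiset.mem_cons_self x s))
      rcases le_total (v (a - algebraMap K Kbar c)) (v (a - algebraMap K Kbar c')) with hle | hle
      · exact ⟨c, Multiset.forall_mem_cons.2 ⟨hle.trans_lt hc', hc⟩⟩
      · exact ⟨c', Multiset.forall_mem_cons.2 ⟨hc', fun r hr => hle.trans_lt (hc r hr)⟩⟩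
  obtain ⟨c, hc⟩ := key
  refine ⟨f.eval c, ?_⟩
  have hlt : v ((s.map fun r => (algebraMap K Kbar c - r) / (a - r)).prod - 1) < 1 := by
    refine map_multiset_prod_sub_one_lt v _ fun x hx => ?_
    obtain ⟨r, hr, rfl⟩ := Multiset.mem_map.1 hx
    have har := (hs r hr).1
    rw [show (algebraMap K Kbar c - r) / (a - r) - 1 = (algebraMap K Kbar c - a) / (a - r) by
      field_simp; ring, map_div₀, div_lt_one₀ (zero_lt_iff.2 (v.ne_zero_iff.2 har)),
      v.map_sub_swap]
    exact hc r hr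
  rw [← hprod, div_sub_one hz0, map_div₀, div_lt_one₀ (zero_lt_iff.2 (v.ne_zero_iff.2 hz0)),
    aeval_algebraMap_apply_eq_algebraMap_eval] at hlt
  exact hlt

theorem ramIndex_eq_one_of_immediate {E : IntermediateField K Kbar}
    (h : ∀ z ∈ E, z ≠ 0 → ∃ c : K, v (algebraMap K Kbar c - z) < v z) : ramIndex v E = 1 := by
  refine Subgroup.relIndex_eq_one.2 ?_
  rintro γ ⟨z, hz, hγ⟩
  obtain ⟨c, hc⟩ := h z hz (by rintro rfl; simp at hγ; exact γ.ne_zero hγ.symm)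
  refine ⟨algebraMap K Kbar c, algebraMap_mem _ c, ?_⟩
  rw [← hγ]
  simpa using v.map_add_eq_of_lt_left hc

theorem inertiaDegree_eq_one_of_immediate {E : IntermediateField K Kbar}
    (h : ∀ z ∈ E, z ≠ 0 → ∃ c : K, v (algebraMap K Kbar c - z) < v z) : inertiaDegree v E = 1 := by
  refine Subfield.relfinrank_eq_one_iff.2 ?_
  rintro _ ⟨z, hz, rfl⟩
  by_cases hz0 : z = 0
  · simp [hz0]
  obtain ⟨c, hc⟩ := h z hz (by simpa using hz0)
  have hz1 : v z ≤ 1 := z.2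
  have hvc : v (algebraMap K Kbar c) = v z := by
    simpa using v.map_add_eq_of_lt_left hc
  refine ⟨⟨algebraMap K Kbar c, hvc.trans_le hz1⟩, algebraMap_mem (⊥ : IntermediateField K Kbar) c,
    ?_⟩
  change IsLocalRing.residue _ _ = IsLocalRing.residue _ _
  rw [← sub_eq_zero, ← map_sub, IsLocalRing.residue_eq_zero_iff]
  exact (mem_maximalIdeal_iff_lt_one v _).2 (hc.trans_le hz1)

/-- A pure generator of a defectless extension has a best approximation in `K`. -/
theorem IsPure.exists_best [IsAlgClosed Kbar] [Algebra.IsAlgebraic K Kbar] {a : Kbar}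
    (h : IsPure K v a) (hdl : IsDefectless v K⟮a⟯) :
    ∃ c : K, a - algebraMap K Kbar c ≠ 0 ∧
      ∀ z : Kbar, deg K z < deg K a → v (a - algebraMap K Kbar c) ≤ v (a - z) := by
  obtain ⟨hdeg, ⟨c, hc⟩ | happ⟩ := h.exists_best_or
  · refine ⟨c, fun h0 => ?_, hc⟩
    rw [(deg_eq_one_iff a).2 ⟨c, (sub_eq_zero.1 h0).symm⟩] at hdeg
    exact lt_irrefl _ hdeg
  · have himm := fun z (hz : z ∈ K⟮a⟯) (hz0 : z ≠ 0) =>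
      exists_sub_algebraMap_lt_of_approx happ hz hz0
    have hfin := IntermediateField.adjoin.finrank (Algebra.IsIntegral.isIntegral (R := K) a)
    unfold IsDefectless at hdl
    rw [ramIndex_eq_one_of_immediate himm, inertiaDegree_eq_one_of_immediate himm, hfin] at hdl
    unfold deg at hdeg
    omega

end Generator

/-! ### Ramification ideals as balls. -/

section RamificationIdeals

variable {K Kbar Γ₀ : Type*} [Field K] [Field Kbar] [Algebra K Kbar]
  [LinearOrderedCommGroupWithZero Γ₀] {v : Valuation Kbar Γ₀} {E : IntermediateField K Kbar}

/-- The ideal of all `y` with `v y * β ≤ γ`. -/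
def ballIdeal (v : Valuation Kbar Γ₀) (E : IntermediateField K Kbar) (β γ : Γ₀) :
    Ideal (valRing v E) where
  carrier := {y | v ((y : E) : Kbar) * β ≤ γ}
  zero_mem' := by simp
  add_mem' := fun {x y} hx hy => by
    have h : v (((x + y : valRing v E) : E) : Kbar) ≤
        max (v ((x : E) : Kbar)) (v ((y : E) : Kbar)) := by
      push_cast
      exact v.map_add _ _
    refine (mul_le_mul_left h β).trans ?_
    rcases max_choice (v ((x : E) : Kbar)) (v ((y : E) : Kbar)) with h | h <;> rw [h]
    exacts [hx, hy]
  smul_mem' := fun c x hx => by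
    have hc : v ((c : E) : Kbar) ≤ 1 := c.2
    change v (((c * x : valRing v E) : E) : Kbar) * β ≤ γ
    push_cast
    rw [map_mul, mul_assoc]
    exact (mul_le_mul' hc hx).trans_eq (one_mul _)

theorem mem_ballIdeal {β γ : Γ₀} {y : valRing v E} :
    y ∈ ballIdeal v E β γ ↔ v ((y : E) : Kbar) * β ≤ γ := Iff.rfl

theorem mem_maximalIdeal_valRing {y : valRing v E} :
    y ∈ IsLocalRing.maximalIdeal (valRing v E) ↔ v ((y : E) : Kbar) < 1 :=
  mem_maximalIdeal_iff_lt_one (v.comap (algebraMap E Kbar)) y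

/-- The subgroup of all automorphisms that move `a` by at most `γ`. -/
def moveSubgroup (hinv : ∀ (σ : E ≃ₐ[K] E) (x : E), v (σ x : Kbar) = v (x : Kbar)) (a : E)
    (γ : Γ₀) : Subgroup (E ≃ₐ[K] E) where
  carrier := {τ | v (τ a - a : Kbar) ≤ γ}
  one_mem' := by simp
  mul_mem' := fun {σ τ} hσ hτ => by
    have : ((σ * τ) a - a : Kbar) = ((σ (τ a - a) : E) : Kbar) + (σ a - a : Kbar) := by
      rw [map_sub, AlgEquiv.mul_apply]
      push_cast
      ring
    change v ((σ * τ) a - a : Kbar) ≤ γ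
    rw [this]
    refine v.map_add_le ?_ hσ
    rw [hinv]
    push_cast
    exact hτ
  inv_mem' := fun {σ} hσ => by
    have : (σ⁻¹ a - a : Kbar) = -((σ⁻¹ (σ a - a) : E) : Kbar) := by
      rw [map_sub, ← AlgEquiv.mul_apply, inv_mul_cancel, AlgEquiv.one_apply]
      push_cast
      ring
    change v (σ⁻¹ a - a : Kbar) ≤ γ
    rw [this, v.map_neg, hinv]
    push_cast
    exact hσ

theorem map_div_sub_one_le_one
    (hinv : ∀ (σ : E ≃ₐ[K] E) (x : E), v (σ x : Kbar) = v (x : Kbar)) (σ : E ≃ₐ[K] E) {z : E}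
    (hz : z ≠ 0) : v ((σ z / z - 1 : E) : Kbar) ≤ 1 := by
  push_cast
  refine v.map_sub_le ?_ (by simp)
  rw [map_div₀, hinv, div_self (v.ne_zero_iff.2 (by simpa using hz))]

variable (hinv : ∀ (σ : E ≃ₐ[K] E) (x : E), v (σ x : Kbar) = v (x : Kbar)) {a b : E}
  (hb : b ≠ 0) (hab : ∀ σ : E ≃ₐ[K] E, σ b - b = σ a - a)
  (hmain : ∀ (σ : E ≃ₐ[K] E) (z : E), z ≠ 0 →
    v ((σ z / z - 1 : E) : Kbar) ≤ v (σ a - a : Kbar) / v (b : Kbar))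
include hb hab

/-- The bound `hmain` is attained at `z = b`; in the application `b = a - c` with `c` the best
approximation in `K`. -/
theorem map_div_sub_one_eq (σ : E ≃ₐ[K] E) :
    v ((σ b / b - 1 : E) : Kbar) * v (b : Kbar) = v (σ a - a : Kbar) := by
  rw [← map_mul, ← IntermediateField.coe_mul, sub_mul, div_mul_cancel₀ _ hb, one_mul, hab]
  push_cast
  rfl

include hinv hmain

/-- By `hmain` no generator has larger `v` than `σ b / b - 1`, and in a valuation ring every element
of at most that value is a multiple of it. -/
theorem ramIdeal_eq_ballIdeal (H : Subgroup (E ≃ₐ[K] E)) {σ : E ≃ₐ[K] E} (hσ : σ ∈ H)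
    (hmax : ∀ τ ∈ H, v (τ a - a : Kbar) ≤ v (σ a - a : Kbar)) :
    ramIdeal v E H = ballIdeal v E (v (b : Kbar)) (v (σ a - a : Kbar)) := by
  have hvb : 0 < v (b : Kbar) := zero_lt_iff.2 (v.ne_zero_iff.2 (by simpa using hb))
  apply le_antisymm
  · refine Ideal.span_le.2 ?_
    rintro y ⟨τ, hτ, z, hz, hy⟩
    have h := hmain τ z hz
    rw [← hy, le_div_iff₀ hvb] at h
    exact h.trans (hmax τ hτ)
  · intro y hy
    rw [mem_ballIdeal, ← map_div_sub_one_eq hb hab σ, mul_le_mul_iff_left₀ hvb] at hy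
    set η : E := σ b / b - 1 with hη
    have hη1 : v (η : Kbar) ≤ 1 := map_div_sub_one_le_one hinv σ hb
    let η' : valRing v E := ⟨η, hη1⟩
    have hmem : η' ∈ ramIdeal v E H := Ideal.subset_span ⟨σ, hσ, b, hb, rfl⟩
    by_cases h0 : η = 0
    · have : y = 0 := by
        rw [h0] at hy
        simpa using hy
      rw [this]
      exact Ideal.zero_mem _
    · have hη0 : 0 < v (η : Kbar) := zero_lt_iff.2 (v.ne_zero_iff.2 (by simpa using h0))
      let q : valRing v E := ⟨(y : E) / η, by
        change v (((y : E) / η : E) : Kbar) ≤ 1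
        push_cast
        rw [map_div₀, div_le_one₀ hη0]
        exact hy⟩
      have : y = q * η' := Subtype.ext (div_mul_cancel₀ _ h0).symm
      rw [this]
      exact Ideal.mul_mem_left _ _ hmem

theorem ram_encard_eq [Finite (E ≃ₐ[K] E)] :
    (Ram v E).encard = {γ | ∃ σ : E ≃ₐ[K] E, σ a ≠ a ∧
      (∀ z : E, z ≠ 0 → v (σ z - z : Kbar) < v (z : Kbar)) ∧ v (σ a - a : Kbar) = γ}.encard := by
  have hvb : 0 < v (b : Kbar) := zero_lt_iff.2 (v.ne_zero_iff.2 (by simpa using hb))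
  have hRam : Ram v E = ballIdeal v E (v (b : Kbar)) '' {γ | ∃ σ : E ≃ₐ[K] E, σ a ≠ a ∧
      (∀ z : E, z ≠ 0 → v (σ z - z : Kbar) < v (z : Kbar)) ∧ v (σ a - a : Kbar) = γ} := by
    ext I
    constructor
    · rintro ⟨hbot, hle, H, rfl⟩
      obtain ⟨σ, hσ, hmax⟩ := Set.exists_max_image (H : Set (E ≃ₐ[K] E))
        (fun τ => v (τ a - a : Kbar)) (Set.toFinite _) ⟨1, H.one_mem⟩
      have heq := ramIdeal_eq_ballIdeal hinv hb hab hmain H hσ hmax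
      refine ⟨_, ⟨σ, fun h0 => hbot ?_, fun z hz => ?_, rfl⟩, heq.symm⟩
      · rw [heq, eq_bot_iff]
        intro y hy
        rw [mem_ballIdeal, h0, sub_self, map_zero, le_zero_iff, mul_eq_zero] at hy
        simpa using hy.resolve_right hvb.ne'
      · have hvz : 0 < v (z : Kbar) := zero_lt_iff.2 (v.ne_zero_iff.2 (by simpa using hz))
        have h1 := map_div_sub_one_le_one hinv σ hz
        have hmem : (⟨σ z / z - 1, h1⟩ : valRing v E) ∈ ramIdeal v E H :=
          Ideal.subset_span ⟨σ, hσ, z, hz, rfl⟩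
        have hlt : v ((σ z / z - 1 : E) : Kbar) < 1 := mem_maximalIdeal_valRing.1 (hle hmem)
        rw [div_sub_one hz] at hlt
        push_cast at hlt
        rwa [map_div₀, div_lt_one₀ hvz] at hlt
    · rintro ⟨_, ⟨σ, hσa, hσ, rfl⟩, rfl⟩
      -- The witness is the largest subgroup whose elements move `a` no further than `σ` does.
      have heq := ramIdeal_eq_ballIdeal hinv hb hab hmain
        (moveSubgroup hinv a (v (σ a - a : Kbar))) (σ := σ) (le_refl (v (σ a - a : Kbar))) fun τ hτ => hτ
      refine ⟨?_, ?_, _, heq.symm⟩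
      · rw [← heq, Ne, ramIdeal, Ideal.span_eq_bot]
        intro h
        have h1 := map_div_sub_one_le_one hinv σ hb
        have h0 := h ⟨σ b / b - 1, h1⟩ ⟨σ, le_refl (v (σ a - a : Kbar)), b, hb, rfl⟩
        have h0' : σ b / b - 1 = 0 := congrArg Subtype.val h0
        have := map_div_sub_one_eq (v := v) hb hab σ
        rw [h0'] at this
        apply hσa
        simpa [sub_eq_zero] using this.symm
      · intro y hy
        rw [mem_maximalIdeal_valRing]
        rw [mem_ballIdeal] at hy
        have hlt := hσ b hb
        have hab' : (σ b - b : Kbar) = σ a - a := by exact_mod_cast congrArg Subtype.val (hab σ)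
        rw [hab'] at hlt
        have := hy.trans_lt hlt
        by_contra! hge
        exact absurd this (not_lt.2 (le_mul_of_one_le_left hvb.le hge))
  rw [hRam]
  refine Set.InjOn.encard_image ?_
  -- A radius is recovered from its ball because it is attained there, by `σ b / b - 1`.
  have key : ∀ γ ∈ {γ | ∃ σ : E ≃ₐ[K] E, σ a ≠ a ∧
      (∀ z : E, z ≠ 0 → v (σ z - z : Kbar) < v (z : Kbar)) ∧ v (σ a - a : Kbar) = γ},
      ∀ γ', ballIdeal v E (v (b : Kbar)) γ ≤ ballIdeal v E (v (b : Kbar)) γ' → γ ≤ γ' := by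
    rintro _ ⟨σ, -, -, rfl⟩ γ' hle
    have h1 := map_div_sub_one_le_one hinv σ hb
    have := hle (show (⟨σ b / b - 1, h1⟩ : valRing v E) ∈ _ from
      (map_div_sub_one_eq hb hab σ).le)
    rw [mem_ballIdeal] at this
    rwa [← map_div_sub_one_eq hb hab σ]
  intro γ hγ γ' hγ' h
  exact le_antisymm (key γ hγ γ' h.le) (key γ' hγ' γ h.ge)

end RamificationIdeals

/-! ### Compactness of the absolute Galois group. -/

section Compactness

variable {K Kbar : Type*} [Field K] [Field Kbar] [Algebra K Kbar] [Normal K Kbar]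

/-- Compactness of the absolute Galois group: pointwise conditions on the separable closure that
are finitely satisfiable by automorphisms are satisfiable. -/
theorem exists_algEquiv_forall_of_finset (Q : Kbar → Kbar → Prop)
    (h : ∀ S : Finset (separableClosure K Kbar),
      ∃ τ : Kbar ≃ₐ[K] Kbar, ∀ x ∈ S, Q x (τ x)) :
    ∃ τ : Kbar ≃ₐ[K] Kbar, ∀ x ∈ separableClosure K Kbar, Q x (τ x) := by
  let N := separableClosure K Kbar
  -- `Gal(N | K)` acts continuously on the discrete field `N`, so each pointwise condition is
  -- closed.
  let _ : TopologicalSpace N := ⊥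
  have _ : DiscreteTopology N := ⟨rfl⟩
  have _ : ContinuousSMul (N ≃ₐ[K] N) N :=
    continuousSMul_iff_stabilizer_isOpen.2 stabilizer_isOpen_of_isIntegral
  have hclosed : ∀ x : N, IsClosed {τ : N ≃ₐ[K] N | Q x (τ x)} := fun x => by
    have hc : Continuous fun τ : N ≃ₐ[K] N => τ • x := by fun_prop
    exact (isClosed_discrete {y : N | Q x y}).preimage hc
  obtain ⟨τ, -, hτ⟩ := isCompact_univ.inter_iInter_nonempty _ hclosed fun S => by
    obtain ⟨τ, hτ⟩ := h S
    refine ⟨τ.restrictNormal N, trivial, ?_⟩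
    simp only [Set.mem_iInter]
    intro x hx
    change Q x (τ.restrictNormal N x : N)
    rw [AlgEquiv.restrictNormal_apply]
    exact hτ x hx
  refine ⟨τ.liftNormal Kbar, fun x hx => ?_⟩
  have := Set.mem_iInter.1 hτ ⟨x, hx⟩
  change Q x (τ.liftNormal Kbar (algebraMap N Kbar ⟨x, hx⟩))
  rw [AlgEquiv.liftNormal_commutes]
  exact this

theorem exists_finite_galois (E : IntermediateField K Kbar) [FiniteDimensional K E]
    (hE : E ≤ separableClosure K Kbar) (S : Finset (separableClosure K Kbar)) :
    ∃ M : IntermediateField K Kbar, FiniteDimensional K M ∧ IsGalois K M ∧ E ≤ M ∧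
      ∀ x ∈ S, (x : Kbar) ∈ M := by
  let T : Set Kbar := Subtype.val '' (S : Set (separableClosure K Kbar))
  have hTfin : Finite T := (S.finite_toSet.image _).to_subtype
  have hT : IntermediateField.adjoin K T ≤ separableClosure K Kbar := by
    rw [IntermediateField.adjoin_le_iff]
    rintro _ ⟨x, -, rfl⟩
    exact x.2
  have _ : FiniteDimensional K (IntermediateField.adjoin K T) :=
    IntermediateField.finiteDimensional_adjoin fun x _ =>
      (Normal.isIntegral inferInstance x : IsIntegral K x)
  let L := E ⊔ IntermediateField.adjoin K T
  have hLN : IntermediateField.normalClosure K L Kbar ≤ separableClosure K Kbar :=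
    IntermediateField.normalClosure_le_iff_of_normal.2 (sup_le hE hT)
  have hle : L ≤ IntermediateField.normalClosure K L Kbar := IntermediateField.le_normalClosure L
  have hsep : Algebra.IsSeparable K (IntermediateField.normalClosure K L Kbar) :=
    (le_separableClosure_iff K Kbar _).1 hLN
  refine ⟨IntermediateField.normalClosure K L Kbar, inferInstance, ⟨⟩, le_sup_left.trans hle,
    fun x hx => hle ?_⟩
  exact (le_sup_right : _ ≤ L) (IntermediateField.subset_adjoin K T ⟨x, hx, rfl⟩)

end Compactness

/-! ### Automorphisms and residues. -/

section Residue

variable {K M F Γ₀ : Type*} [Field K] [Field M] [Algebra K M] [Field F]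
  [LinearOrderedCommGroupWithZero Γ₀]

/-- An embedding `τ` of `M` that is trivial on the residues of the fixed field of a finite group
`H` agrees modulo the maximal ideal with some element of `H`, uniformly on finite families. -/
theorem exists_mem_forall_sub_lt_one (v : Valuation F Γ₀) (ι τ : M →+* F)
    (hτ : ∀ x, v (τ x) = v (ι x)) (H : Subgroup (M ≃ₐ[K] M)) [Finite H]
    (hH : ∀ h ∈ H, ∀ x, v (ι (h x)) = v (ι x))
    (hfix : ∀ c, (∀ h ∈ H, h c = c) → v (ι c) ≤ 1 → v (τ c - ι c) < 1)
    {n : ℕ} (x : Fin n → M) (hx : ∀ i, v (ι (x i)) ≤ 1) :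
    ∃ h ∈ H, ∀ i, v (τ (x i) - ι (h (x i))) < 1 := by
  classical
  have _ := Fintype.ofFinite H
  let A := (v.comap ι).valuationSubring
  let B := v.valuationSubring
  let bh : H → A →+* A := fun h =>
    ((h : M ≃ₐ[K] M) : M →+* M).restrict A A fun y hy => (hH h h.2 y).trans_le hy
  let rι : A →+* IsLocalRing.ResidueField B :=
    (IsLocalRing.residue B).comp (ι.restrict A B fun y hy => hy)
  let rτ : A →+* IsLocalRing.ResidueField B :=
    (IsLocalRing.residue B).comp (τ.restrict A B fun y hy => (hτ y).trans_le hy)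
  -- The whole family is packed into one polynomial, so that a single `h` serves all indices.
  let q : A[X] := Polynomial.ofFn n fun i => (⟨x i, hx i⟩ : A)
  have hq : ∀ i : Fin n, q.coeff i = ⟨x i, hx i⟩ := fun i =>
    Polynomial.ofFn_coeff_eq_val_of_lt _ i.2
  let P : A[X][X] := ∏ h : H, (X - C (q.map (bh h)))
  have hmul : ∀ g h : H, (bh g).comp (bh h) = bh (g * h) := fun g h => rfl
  have hone : bh 1 = RingHom.id A := rfl
  have hPfix : ∀ g : H, P.map (mapRingHom (bh g)) = P := fun g => by
    rw [Polynomial.map_prod]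
    refine Fintype.prod_equiv (Equiv.mulLeft g) _ _ fun h => ?_
    -- Acting by `g` only permutes the factors of `P`, so its coefficients are fixed by `H` and
    -- `hfix` applies to them.
    rw [Polynomial.map_sub, map_X, map_C, coe_mapRingHom, Polynomial.map_map, hmul]
    rfl
  have hP : P.map (mapRingHom rτ) = P.map (mapRingHom rι) := by
    ext i j
    rw [coeff_map, coeff_map, coe_mapRingHom, coe_mapRingHom, coeff_map, coeff_map]
    set c := (P.coeff i).coeff j with hc
    have hcfix : ∀ h ∈ H, h (c : M) = c := fun h hh => by
      have h1 := congrArg (fun p => (p.coeff i).coeff j) (hPfix ⟨h, hh⟩)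
      simp only [coeff_map, coe_mapRingHom] at h1
      exact congrArg Subtype.val h1
    have hlt := hfix c hcfix c.2
    rw [← sub_eq_zero]
    change IsLocalRing.residue B _ - IsLocalRing.residue B _ = 0
    rw [← map_sub, IsLocalRing.residue_eq_zero_iff]
    exact (mem_maximalIdeal_iff_lt_one v _).2 hlt
  -- At the reduction of `q` via `τ`, the left side vanishes through the factor `h = 1`; hence some
  -- factor on the right vanishes too.
  have hev := congrArg (eval (q.map rτ)) hP
  have hl : eval (q.map rτ) (P.map (mapRingHom rτ)) = 0 := by
    rw [Polynomial.map_prod, eval_prod]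
    refine Finset.prod_eq_zero (Finset.mem_univ 1) ?_
    rw [hone, Polynomial.map_id, Polynomial.map_sub, map_X, map_C, coe_mapRingHom, eval_sub, eval_X,
      eval_C, sub_self]
  rw [hl, Polynomial.map_prod, eval_prod] at hev
  obtain ⟨h, -, hh⟩ := Finset.prod_eq_zero_iff.1 hev.symm
  rw [Polynomial.map_sub, map_X, map_C, coe_mapRingHom, eval_sub, eval_X, eval_C,
    Polynomial.map_map] at hh
  refine ⟨h, h.2, fun i => ?_⟩
  have h1 := congrArg (fun p => p.coeff i) hh
  simp only [coeff_sub, coeff_map, hq, coeff_zero] at h1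
  change IsLocalRing.residue B _ - IsLocalRing.residue B _ = 0 at h1
  rw [← map_sub, IsLocalRing.residue_eq_zero_iff] at h1
  exact (mem_maximalIdeal_iff_lt_one v _).1 h1

end Residue

/-! ### Lifting inertia. -/

section Inertia

variable {K Kbar Γ₀ : Type*} [Field K] [Field Kbar] [Algebra K Kbar] [Normal K Kbar]
  [LinearOrderedCommGroupWithZero Γ₀] {v : Valuation Kbar Γ₀}
  (hinv : ∀ (σ : Kbar ≃ₐ[K] Kbar) (x : Kbar), v (σ x) = v x)
include hinv

/-- In a finite Galois `M | K` containing `E` and `S`, the group `Gal(M | E)` has fixed field `E`,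
on whose residues `τ` is trivial; so `exists_mem_forall_sub_lt_one` applies. -/
theorem exists_fixing_forall_finset {E : IntermediateField K Kbar} [FiniteDimensional K E]
    (hE : E ≤ separableClosure K Kbar) {τ : Kbar ≃ₐ[K] Kbar}
    (hτ : ∀ x ∈ E, v x ≤ 1 → v (τ x - x) < 1) (S : Finset (separableClosure K Kbar)) :
    ∃ ρ : Kbar ≃ₐ[K] Kbar, (∀ x ∈ E, ρ x = x) ∧
      ∀ x ∈ S, v (x : Kbar) ≤ 1 → v (τ x - ρ x) < 1 := by
  classical
  obtain ⟨M, _, _, hEM, hSM⟩ := exists_finite_galois E hE S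
  let H := (IntermediateField.restrict hEM).fixingSubgroup
  let S' : Finset (separableClosure K Kbar) := {x ∈ S | v (x : Kbar) ≤ 1}
  have hS' : ∀ x ∈ S', (x : Kbar) ∈ M := fun x hx => hSM x (Finset.mem_of_mem_filter x hx)
  let e := S'.equivFin
  obtain ⟨h, hh, hx⟩ := exists_mem_forall_sub_lt_one v (algebraMap M Kbar)
    ((τ : Kbar →+* Kbar).comp (algebraMap M Kbar)) (fun x => hinv τ x) H
    (fun h _ x => by rw [← AlgEquiv.liftNormal_commutes h Kbar, hinv])
    (fun c hc hc1 => by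
      refine hτ c ?_ hc1
      have hc' : c ∈ IntermediateField.fixedField H := fun g => hc g g.2
      rw [IsGalois.fixedField_fixingSubgroup] at hc'
      exact (IntermediateField.mem_restrict hEM c).1 hc')
    (fun i => ⟨((e.symm i : S') : separableClosure K Kbar), hS' _ (e.symm i).2⟩)
    (fun i => (Finset.mem_filter.1 (e.symm i).2).2)
  refine ⟨h.liftNormal Kbar, fun x hx => ?_, fun x hxS hx1 => ?_⟩
  · have h1 := AlgEquiv.liftNormal_commutes h Kbar (⟨x, hEM hx⟩ : M)
    have h2 : h ⟨x, hEM hx⟩ = ⟨x, hEM hx⟩ :=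
      (IntermediateField.mem_fixingSubgroup_iff _ _).1 hh _
        ((IntermediateField.mem_restrict hEM _).2 hx)
    rw [h2] at h1
    exact h1
  · have hxS' : x ∈ S' := Finset.mem_filter.2 ⟨hxS, hx1⟩
    have h1 := hx (e ⟨x, hxS'⟩)
    simp only [Equiv.symm_apply_apply] at h1
    rw [← AlgEquiv.liftNormal_commutes h Kbar] at h1
    exact h1

/-- Inertia groups surject onto each other. -/
theorem exists_inertia_lift {E : IntermediateField K Kbar} [FiniteDimensional K E] [Normal K E]
    (hE : E ≤ separableClosure K Kbar) {τ : Kbar ≃ₐ[K] Kbar}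
    (hτ : ∀ x ∈ E, v x ≤ 1 → v (τ x - x) < 1) :
    ∃ σ : Kbar ≃ₐ[K] Kbar, (∀ x ∈ E, σ x = τ x) ∧
      ∀ x ∈ separableClosure K Kbar, v x ≤ 1 → v (σ x - x) < 1 := by
  obtain ⟨ρ, hρ⟩ := exists_algEquiv_forall_of_finset (K := K)
    (fun x y => (x ∈ E → y = x) ∧ (v x ≤ 1 → v (τ x - y) < 1)) fun S => by
      obtain ⟨ρ, h1, h2⟩ := exists_fixing_forall_finset hinv hE hτ S
      exact ⟨ρ, fun x hx => ⟨h1 x, h2 x hx⟩⟩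
  -- `ρ` fixes `E` and acts on residues as `τ` does, so this correction changes nothing on `E` and
  -- trivializes the residue action.
  refine ⟨ρ.symm * τ, fun x hx => ?_, fun x hx hx1 => ?_⟩
  · have hτx : τ x ∈ E := by
      rw [← AlgEquiv.restrictNormal_apply E τ ⟨x, hx⟩]
      exact SetLike.coe_mem _
    rw [AlgEquiv.mul_apply, AlgEquiv.symm_apply_eq]
    exact ((hρ _ (hE hτx)).1 hτx).symm
  · rw [← hinv ρ, map_sub, AlgEquiv.mul_apply, AlgEquiv.apply_symm_apply]
    exact (hρ x hx).2 hx1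

end Inertia

/-! ### The residue characteristic exponent. -/

section CharExponent

variable {K Kbar Γ₀ : Type*} [Field K] [Field Kbar] [Algebra K Kbar]
  [LinearOrderedCommGroupWithZero Γ₀] (v : Valuation Kbar Γ₀)

variable (K) in
theorem expChar_residueField :
    ExpChar (IsLocalRing.ResidueField v.valuationSubring) (charExponent K v) :=
  have : ExpChar (resField v (⊥ : IntermediateField K Kbar)) (charExponent K v) :=
    ringExpChar.expChar _
  expChar_of_injective_ringHom
    (resField v (⊥ : IntermediateField K Kbar)).subtype.injective _

theorem exists_eq_pow_mul_coprime {R : Type*} [Semiring R] (p : ℕ) [hp : ExpChar R p] {n : ℕ}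
    (hn : n ≠ 0) : ∃ s m, n = p ^ s * m ∧ m ≠ 0 ∧ Nat.Coprime m p := by
  rcases hp with _ | hprime
  · exact ⟨0, n, by simp, hn, Nat.coprime_one_right n⟩
  · obtain ⟨s, m, hm, hnm⟩ := Nat.exists_eq_pow_mul_and_not_dvd hn p hprime.ne_one
    refine ⟨s, m, hnm, ?_, (hprime.coprime_iff_not_dvd.2 hm).symm⟩
    rintro rfl
    exact hn (by simpa using hnm)

variable (K) in
theorem map_natCast_eq_one {m : ℕ} (hm : m ≠ 0) (hcop : Nat.Coprime m (charExponent K v)) :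
    v (m : Kbar) = 1 := by
  have hle : ∀ k : ℕ, v (k : Kbar) ≤ 1 := fun k => by
    induction k with
    | zero => simp
    | succ k ih =>
      rw [Nat.cast_succ]
      exact v.map_add_le ih (by simp)
  refine le_antisymm (hle m) (not_lt.1 fun hlt => ?_)
  have h0 : ((m : ℕ) : IsLocalRing.ResidueField v.valuationSubring) = 0 := by
    rw [← map_natCast (IsLocalRing.residue v.valuationSubring), IsLocalRing.residue_eq_zero_iff,
      mem_maximalIdeal_iff_lt_one]
    simpa using hlt
  have hp := expChar_residueField K v
  revert hcop hp
  generalize charExponent K v = p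
  rintro hcop (_ | hprime)
  · exact hm (Nat.cast_eq_zero.1 h0)
  · have := (CharP.cast_eq_zero_iff _ p m).1 h0
    exact hprime.ne_one (Nat.dvd_one.1 (hcop ▸ Nat.dvd_gcd this dvd_rfl))

-- Frobenius is injective on the residue field: `(u - 1) ^ p ^ s` and `u ^ p ^ s - 1` have the same
-- residue.
variable (K) in
theorem map_sub_one_lt_of_pow {u : Kbar} (hu : v u ≤ 1) {s : ℕ}
    (h : v (u ^ charExponent K v ^ s - 1) < 1) : v (u - 1) < 1 := by
  have hp := expChar_residueField K v
  let u' : v.valuationSubring := ⟨u, hu⟩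
  have h1 : IsLocalRing.residue _ (u' ^ charExponent K v ^ s - 1) = 0 := by
    rw [IsLocalRing.residue_eq_zero_iff, mem_maximalIdeal_iff_lt_one]
    exact h
  have h2 : IsLocalRing.residue _ (u' - 1) = 0 := by
    rw [map_sub, map_one, map_pow] at h1
    rw [map_sub, map_one]
    refine eq_zero_of_pow_eq_zero (n := charExponent K v ^ s) ?_
    rw [sub_pow_expChar_pow, one_pow, h1]
  rw [IsLocalRing.residue_eq_zero_iff, mem_maximalIdeal_iff_lt_one] at h2
  exact h2

end CharExponent

/-! ### Lifting ramification. -/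

section RamificationGroups

variable {K Kbar Γ₀ : Type*} [Field K] [Field Kbar] [Algebra K Kbar]
  [LinearOrderedCommGroupWithZero Γ₀] {v : Valuation Kbar Γ₀}

theorem algEquiv_mem (E : IntermediateField K Kbar) [Normal K E] (σ : Kbar ≃ₐ[K] Kbar) {x : Kbar}
    (hx : x ∈ E) : σ x ∈ E := by
  rw [← AlgEquiv.restrictNormal_apply E σ ⟨x, hx⟩]
  exact SetLike.coe_mem _

theorem exists_pow_fixing [Normal K Kbar] (M : IntermediateField K Kbar) [FiniteDimensional K M]
    [Normal K M] (σ : Kbar ≃ₐ[K] Kbar) : ∃ n ≠ 0, ∀ x ∈ M, (σ ^ n) x = x := by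
  let g := AlgEquiv.restrictNormalHom M σ
  refine ⟨orderOf g, (orderOf_pos g).ne', fun x hx => ?_⟩
  have h : AlgEquiv.restrictNormalHom M (σ ^ orderOf g) = 1 := by
    rw [map_pow, pow_orderOf_eq_one]
  have := AlgEquiv.restrictNormal_apply M (σ ^ orderOf g) ⟨x, hx⟩
  rw [← this]
  exact congrArg Subtype.val (DFunLike.congr_fun h (⟨x, hx⟩ : M))

variable (hinv : ∀ (σ : Kbar ≃ₐ[K] Kbar) (x : Kbar), v (σ x) = v x)
include hinv

theorem map_pow_sub_lt {σ : Kbar ≃ₐ[K] Kbar} {x : Kbar} {γ : Γ₀} (h : v (σ x - x) < γ) (j : ℕ) :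
    v ((σ ^ j) x - x) < γ := by
  induction j with
  | zero => simpa using zero_le.trans_lt h
  | succ j ih =>
    rw [show (σ ^ (j + 1)) x - x = (σ ^ j) (σ x - x) + ((σ ^ j) x - x) by
      rw [pow_succ, AlgEquiv.mul_apply, map_sub]; ring]
    exact v.map_add_lt (by rwa [hinv]) ih

/-- A ramification group has no nontrivial elements of order invertible in the residue field. -/
theorem fixing_of_pow_fixing {E : IntermediateField K Kbar} [Normal K E] {σ : Kbar ≃ₐ[K] Kbar}
    (hσ : ∀ z ∈ E, z ≠ 0 → v (σ z - z) < v z) {m : ℕ} (hm : v (m : Kbar) = 1)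
    (hpow : ∀ z ∈ E, (σ ^ m) z = z) {x : Kbar} (hx : x ∈ E) : σ x = x := by
  have hm0 : (m : Kbar) ≠ 0 := by
    rintro h
    simp [h] at hm
  set t := ∑ i ∈ Finset.range m, (σ ^ i) x with ht
  have hσt : σ t = t := by
    have h1 := Finset.sum_range_succ' (fun i => (σ ^ i) x) m
    rw [Finset.sum_range_succ, hpow x hx, pow_zero, AlgEquiv.one_apply, add_left_inj] at h1
    rw [ht, map_sum, h1]
    refine Finset.sum_congr rfl fun i _ => ?_
    rw [pow_succ', AlgEquiv.mul_apply]
  have htE : t ∈ E := sum_mem fun i _ => algEquiv_mem E _ hx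
  have hσit : ∀ i : ℕ, (σ ^ i) t = t := fun i => by
    induction i with
    | zero => simp
    | succ i ih => rw [pow_succ, AlgEquiv.mul_apply, hσt, ih]
  -- `y` has trace zero, but each `σ ^ i y` is `y` up to smaller terms, so the trace is `m y` up to
  -- smaller terms. As `v m = 1`, this forces `y = 0`.
  set y := m * x - t with hy
  have hsum : ∑ i ∈ Finset.range m, (σ ^ i) y = 0 := by
    simp only [hy, map_sub, map_mul, map_natCast, hσit, Finset.sum_sub_distrib, ← Finset.mul_sum,
      ← ht, Finset.sum_const, Finset.card_range, nsmul_eq_mul, sub_self]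
  have hy0 : y = 0 := by
    by_contra hy0
    have hyE : y ∈ E := sub_mem (mul_mem (natCast_mem E m) hx) htE
    have hlt : v (∑ i ∈ Finset.range m, ((σ ^ i) y - y)) < v y :=
      v.map_sum_lt (v.ne_zero_iff.2 hy0) fun i _ => map_pow_sub_lt hinv (hσ y hyE hy0) i
    rw [Finset.sum_sub_distrib, hsum, Finset.sum_const, Finset.card_range, nsmul_eq_mul, zero_sub,
      v.map_neg, map_mul, hm, one_mul] at hlt
    exact lt_irrefl _ hlt
  have hmx : (m : Kbar) * x = t := sub_eq_zero.1 hy0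
  refine mul_left_cancel₀ hm0 ?_
  rw [hmx, ← hσt, ← hmx, map_mul, map_natCast]

/-- An element of the inertia group whose order on `z` is a power of the residue characteristic
satisfies the ramification condition at `z`. -/
theorem map_sub_lt_of_pow_fixing {N : IntermediateField K Kbar} [Normal K N]
    {τ : Kbar ≃ₐ[K] Kbar} (hτ : ∀ x ∈ N, v x ≤ 1 → v (τ x - x) < 1) {z : Kbar} (hz : z ∈ N)
    (hz0 : z ≠ 0) {s : ℕ} (hpow : (τ ^ charExponent K v ^ s) z = z) : v (τ z - z) < v z := by
  have hvz : v z ≠ 0 := v.ne_zero_iff.2 hz0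
  set u := τ z / z with hu
  have hvu : v u = 1 := by rw [hu, map_div₀, hinv, div_self hvz]
  -- Since `τ` is trivial on residues, `i ↦ τ ^ i z / z` is multiplicative modulo the maximal ideal.
  -- At `i = p ^ s` this makes the residue of `u ^ p ^ s` equal to `1`.
  have hind : ∀ i : ℕ, v ((τ ^ i) z / z - u ^ i) < 1 := fun i => by
    induction i with
    | zero => simp [hz0]
    | succ i ih =>
      have h1 : (τ ^ (i + 1)) z / z - u ^ (i + 1) =
          ((τ ^ i) u - u) * ((τ ^ i) z / z) + u * ((τ ^ i) z / z - u ^ i) := by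
        rw [show (τ ^ (i + 1)) z = (τ ^ i) u * (τ ^ i) z by
          rw [pow_succ, AlgEquiv.mul_apply, ← map_mul, hu, div_mul_cancel₀ _ hz0]]
        ring
      rw [h1]
      refine v.map_add_lt ?_ ?_
      · rw [map_mul, map_div₀ v, hinv, div_self hvz, mul_one]
        exact map_pow_sub_lt hinv (hτ u (div_mem (algEquiv_mem N τ hz) hz) hvu.le) i
      · rwa [map_mul, hvu, one_mul]
  have h := hind (charExponent K v ^ s)
  rw [hpow, div_self hz0, v.map_sub_swap] at h
  have h1 := map_sub_one_lt_of_pow K v hvu.le h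
  rwa [hu, div_sub_one hz0, map_div₀, div_lt_one₀ (zero_lt_iff.2 hvz)] at h1

/-- The absolute ramification group surjects onto the ramification group of a finite Galois
extension. -/
theorem exists_mem_absRamGroup_eqOn [Normal K Kbar] {E : IntermediateField K Kbar}
    [FiniteDimensional K E] [Normal K E] (hE : E ≤ separableClosure K Kbar) {σ : Kbar ≃ₐ[K] Kbar}
    (hσ : ∀ z ∈ E, z ≠ 0 → v (σ z - z) < v z) :
    ∃ τ ∈ absRamGroup K v, ∀ x ∈ E, τ x = σ x := by
  have _ := expChar_residueField K v
  obtain ⟨τ₀, hτ₀σ, hτ₀⟩ := exists_inertia_lift hinv hE (τ := σ) fun x hx hx1 => by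
    by_cases hx0 : x = 0
    · simp [hx0]
    · exact (hσ x hx hx0).trans_le hx1
  have hpowE : ∀ (i : ℕ), ∀ x ∈ E, (τ₀ ^ i) x = (σ ^ i) x := fun i => by
    induction i with
    | zero => simp
    | succ i ih =>
      intro x hx
      rw [pow_succ, pow_succ, AlgEquiv.mul_apply, AlgEquiv.mul_apply, hτ₀σ x hx,
        ih _ (algEquiv_mem E σ hx)]
  obtain ⟨τ, hτ⟩ := exists_algEquiv_forall_of_finset (K := K)
    (fun x y => (x ∈ E → y = σ x) ∧ (x ≠ 0 → v (y - x) < v x)) fun S => by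
      obtain ⟨M, _, _, hEM, hSM⟩ := exists_finite_galois E hE S
      obtain ⟨n, hn0, hn⟩ := exists_pow_fixing M τ₀
      obtain ⟨s, m, rfl, hm0, hcop⟩ := exists_eq_pow_mul_coprime
        (R := IsLocalRing.ResidueField v.valuationSubring) (charExponent K v) hn0
      set p := charExponent K v with hp
      -- On `E` the `m`-th power of `σ ^ p ^ s` is trivial and `m` is a unit in the residue field.
      have hσp : ∀ x ∈ E, (σ ^ p ^ s) x = x := fun x hx =>
        fixing_of_pow_fixing hinv (fun z hz hz0 => map_pow_sub_lt hinv (hσ z hz hz0) _)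
          (map_natCast_eq_one K v hm0 hcop)
          (fun z hz => by rw [← pow_mul, ← hpowE _ z hz, hn z (hEM hz)]) hx
      -- With `j ≡ 1` modulo `p ^ s` and `j ≡ 0` modulo `m`, the power `τ₀ ^ j` still induces `σ` on
      -- `E` and has `p`-power order on `M`.
      obtain ⟨j, hj1, hj0⟩ := Nat.chineseRemainder (hcop.pow_right s).symm 1 0
      refine ⟨τ₀ ^ j, fun x hx => ⟨fun hxE => ?_, fun hx0 => ?_⟩⟩
      · rw [hpowE j x hxE]
        have hg : (AlgEquiv.restrictNormalHom E σ) ^ p ^ s = 1 := by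
          rw [← map_pow]
          ext y
          rw [AlgEquiv.restrictNormalHom_apply, hσp y y.2]
          rfl
        have hgj := pow_eq_pow_of_modEq hj1 hg
        rw [pow_one, ← map_pow] at hgj
        have := congrArg Subtype.val (DFunLike.congr_fun hgj (⟨x, hxE⟩ : E))
        rwa [AlgEquiv.restrictNormalHom_apply, AlgEquiv.restrictNormalHom_apply] at this
      · refine map_sub_lt_of_pow_fixing hinv (N := separableClosure K Kbar) (s := s)
          (fun y hy hy1 => map_pow_sub_lt hinv (hτ₀ y hy hy1) j) x.2 hx0 ?_
        obtain ⟨q, rfl⟩ := Nat.modEq_zero_iff_dvd.1 hj0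
        have hfix : ∀ i : ℕ, ((τ₀ ^ (p ^ s * m)) ^ i) (x : Kbar) = x := fun i => by
          induction i with
          | zero => simp
          | succ i ih => rw [pow_succ, AlgEquiv.mul_apply, hn x (hSM x hx), ih]
        rw [← pow_mul, show m * q * p ^ s = p ^ s * m * q by ring, pow_mul]
        exact hfix q
  exact ⟨τ, fun x hx hx0 => (hτ x hx).2 hx0, fun x hx => (hτ x (hE hx)).1 hx⟩

end RamificationGroups

/-! ### The ramification field and conjugates. -/

section RamificationField

variable {K Kbar Γ₀ : Type*} [Field K] [Field Kbar] [Algebra K Kbar] [Normal K Kbar]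
  [LinearOrderedCommGroupWithZero Γ₀] {v : Valuation Kbar Γ₀}
  (hinv : ∀ (σ : Kbar ≃ₐ[K] Kbar) (x : Kbar), v (σ x) = v x)

/-- The absolute ramification group as a subgroup. -/
def absRamSubgroup : Subgroup (Kbar ≃ₐ[K] Kbar) where
  carrier := absRamGroup K v
  one_mem' := fun a _ ha0 => by simpa [zero_lt_iff] using ha0
  mul_mem' := fun {σ τ} hσ hτ a ha ha0 => by
    rw [show (σ * τ) a - a = σ (τ a - a) + (σ a - a) by
      rw [AlgEquiv.mul_apply, map_sub]; ring]
    exact v.map_add_lt (by rw [hinv]; exact hτ a ha ha0) (hσ a ha ha0)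
  inv_mem' := fun {σ} hσ a ha ha0 => by
    rw [← hinv σ, map_sub, ← AlgEquiv.mul_apply, mul_inv_cancel, AlgEquiv.one_apply,
      v.map_sub_swap]
    exact hσ a ha ha0

include hinv

/-- The automorphisms that are trivial on `E ∩ K^r` are those inducing elements of the ramification
group of `E | K`. -/
theorem fixing_inf_absRamField_iff {E : IntermediateField K Kbar} [FiniteDimensional K E]
    [IsGalois K E] (σ : Kbar ≃ₐ[K] Kbar) :
    (∀ x ∈ E ⊓ absRamField K v, σ x = x) ↔ ∀ z ∈ E, z ≠ 0 → v (σ z - z) < v z := by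
  have hE : E ≤ separableClosure K Kbar := le_separableClosure K Kbar E
  constructor
  · intro h
    -- The fixed field of this image lies in `E ∩ K^r`, so the Galois correspondence puts the
    -- restriction of `σ` in `H`.
    let H := (absRamSubgroup hinv).map (AlgEquiv.restrictNormalHom E)
    have hσH : AlgEquiv.restrictNormalHom E σ ∈ H := by
      rw [← IntermediateField.fixingSubgroup_fixedField H,
        IntermediateField.mem_fixingSubgroup_iff]
      intro y hy
      apply Subtype.ext
      rw [AlgEquiv.restrictNormalHom_apply]
      refine h y ⟨y.2, hE y.2, fun τ hτ => ?_⟩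
      have h1 := hy ⟨_, τ, hτ, rfl⟩
      rw [← AlgEquiv.restrictNormalHom_apply E τ y]
      exact congrArg Subtype.val h1
    obtain ⟨τ, hτ, hτσ⟩ := hσH
    intro z hz hz0
    have : τ z = σ z := by
      have h1 := congrArg Subtype.val (DFunLike.congr_fun hτσ (⟨z, hz⟩ : E))
      rwa [AlgEquiv.restrictNormalHom_apply, AlgEquiv.restrictNormalHom_apply] at h1
    rw [← this]
    exact hτ z (hE hz) hz0
  · intro h x hx
    obtain ⟨τ, hτ, hτσ⟩ := exists_mem_absRamGroup_eqOn hinv hE h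
    rw [← hτσ x hx.1]
    exact hx.2.2 τ hτ

-- The `F`-conjugates of `a` are its images under `Gal(Kbar | F)`, and `hF` identifies the
-- restrictions to `E` with the ramification group. It serves both for `F = L` and for `F = K`.
omit hinv in
theorem conjValues_eq {F : Type*} [Field F] [Algebra F Kbar] [Algebra K F] [IsScalarTower K F Kbar]
    [Normal F Kbar] {E : IntermediateField K Kbar} [Normal K E] (a : E)
    (hF : ∀ σ : Kbar ≃ₐ[K] Kbar, (∀ x : F, σ (algebraMap F Kbar x) = algebraMap F Kbar x) ↔
      ∀ z ∈ E, z ≠ 0 → v (σ z - z) < v z) :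
    conjValues F v (a : Kbar) = {γ | ∃ σ : E ≃ₐ[K] E, σ a ≠ a ∧
      (∀ z : E, z ≠ 0 → v (σ z - z : Kbar) < v (z : Kbar)) ∧ v (σ a - a : Kbar) = γ} := by
  ext γ
  constructor
  · rintro ⟨a', hne, hconj, rfl⟩
    obtain ⟨s, hs⟩ := hconj.symm.exists_algEquiv
    let σ : Kbar ≃ₐ[K] Kbar := s.restrictScalars K
    have hσ := (hF σ).1 fun x => s.commutes x
    have hres : ∀ z : E, (σ.restrictNormal E z : Kbar) = σ z := AlgEquiv.restrictNormal_apply E σ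
    have ha' : σ a = a' := hs
    refine ⟨σ.restrictNormal E, fun h => hne ?_, fun z hz => ?_, ?_⟩
    · rw [← ha', ← hres, h]
    · rw [hres]
      exact hσ z z.2 (by simpa using hz)
    · rw [hres, ha', v.map_sub_swap]
  · rintro ⟨σ, hne, hσ, rfl⟩
    have hres : ∀ z : E, σ.liftNormal Kbar (z : Kbar) = (σ z : Kbar) :=
      AlgEquiv.liftNormal_commutes σ Kbar
    have hfix := (hF (σ.liftNormal Kbar)).2 fun z hz hz0 => by
      have h1 := hσ ⟨z, hz⟩ (by simpa [Subtype.ext_iff] using hz0)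
      rwa [← hres] at h1
    let s : Kbar ≃ₐ[F] Kbar := { σ.liftNormal Kbar with commutes' := hfix }
    have hs : s (a : Kbar) = (σ a : Kbar) := hres a
    refine ⟨(σ a : Kbar), fun h => hne (Subtype.ext h), ?_, v.map_sub_swap _ _⟩
    rw [← hs]
    exact isConjRoot_of_algEquiv _ s

omit [Normal K Kbar] in
/-- All automorphisms of a purely wild extension belong to its ramification group. -/
theorem IsPurelyWild.map_sub_lt {E : IntermediateField K Kbar} (h : IsPurelyWild v E)
    (σ : Kbar ≃ₐ[K] Kbar) {z : Kbar} (hz : z ∈ E) (hz0 : z ≠ 0) : v (σ z - z) < v z := by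
  have hvz : v z ≠ 0 := v.ne_zero_iff.2 hz0
  obtain ⟨n, c, hc, hcz⟩ := h.1 (Units.mk0 (v z) hvz) ⟨z, hz, rfl⟩
  set p := charExponent K v with hp
  have hvc : v c = v z ^ p ^ n := by simpa using hcz
  have hc0 : c ≠ 0 := v.ne_zero_iff.1 (by rw [hvc]; exact pow_ne_zero _ hvz)
  obtain ⟨c, rfl⟩ := IntermediateField.mem_bot.1 hc
  -- `u` is a unit, and the residue of some `u ^ p ^ m` lies in `Kv`, hence is fixed by `σ`. As `(σ
  -- z / z) ^ p ^ n = σ u / u`, a `p`-power of `σ z / z` has residue `1`.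
  set u := z ^ p ^ n / algebraMap K Kbar c with hu
  have hvu : v u = 1 := by
    rw [hu, map_div₀, map_pow, hvc, div_self (pow_ne_zero _ hvz)]
  have huE : u ∈ E := div_mem (pow_mem hz _) (algebraMap_mem E c)
  let u' : v.valuationSubring := ⟨u, hvu.le⟩
  obtain ⟨m, d, hd, hdu⟩ := h.2 (IsLocalRing.residue _ u') ⟨u', huE, rfl⟩
  obtain ⟨d₀, hd₀⟩ := IntermediateField.mem_bot.1 hd
  have hlt : v (u ^ p ^ m - algebraMap K Kbar d₀) < 1 := by
    rw [← map_pow, eq_comm, ← sub_eq_zero, ← map_sub, IsLocalRing.residue_eq_zero_iff,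
      mem_maximalIdeal_iff_lt_one] at hdu
    rw [hd₀]
    exact hdu
  have hlt' : v (σ u ^ p ^ m - algebraMap K Kbar d₀) < 1 := by
    rw [← hinv σ, map_sub, map_pow, σ.commutes] at hlt
    exact hlt
  have hlt'' : v (σ u ^ p ^ m - u ^ p ^ m) < 1 := by
    rw [← sub_sub_sub_cancel_right _ _ (algebraMap K Kbar d₀)]
    exact v.map_sub_lt hlt' hlt
  have hw : v ((σ z / z) ^ p ^ (n + m) - 1) < 1 := by
    have hu0 : u ≠ 0 := by
      rintro h0
      simp [h0] at hvu
    have hcc : algebraMap K Kbar c ≠ 0 := hc0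
    have h1 : (σ z / z) ^ p ^ n = σ u / u := by
      rw [hu, map_div₀, map_pow, σ.commutes, div_pow]
      field_simp
    rw [pow_add, pow_mul, h1, div_pow, div_sub_one (pow_ne_zero _ hu0), map_div₀, map_pow v u, hvu,
      one_pow, div_one]
    exact hlt''
  have h1 := map_sub_one_lt_of_pow K v (u := σ z / z)
    (by rw [map_div₀, hinv, div_self hvz]) hw
  rwa [div_sub_one hz0, map_div₀, div_lt_one₀ (zero_lt_iff.2 hvz)] at h1

end RamificationField

end HenselRam

theorem theorem8p13 {K Kbar Γ₀ : Type*} [Field K] [Field Kbar] [Algebra K Kbar]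
    [IsAlgClosure K Kbar] [LinearOrderedCommGroupWithZero Γ₀]
    (v : Valuation Kbar Γ₀) (hens : HenselRam.IsHenselianValued K v)
    (Ω : IntermediateField K Kbar) [FiniteDimensional K Ω] [IsGalois K Ω]
    (hdefectless : HenselRam.IsDefectless v Ω)
    (hdepth : HenselRam.extDepth v Ω = 1)
    (hnottame : ¬ HenselRam.IsTame v Ω)
    (a : Kbar) (hgen : IntermediateField.adjoin K {a} = Ω) (hpure : HenselRam.IsPure K v a) :
    (HenselRam.Ram v Ω).encard =
        (HenselRam.conjValues ↥(Ω ⊓ HenselRam.absRamField K v) v a).encard ∧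
      (HenselRam.IsPurelyWild v Ω →
        (HenselRam.Ram v Ω).encard = (HenselRam.conjValues K v a).encard) := by
  have _ : IsAlgClosed Kbar := IsAlgClosure.isAlgClosed K
  have _ : Algebra.IsAlgebraic K Kbar := IsAlgClosure.isAlgebraic
  have _ : Normal K Kbar := IsAlgClosure.normal K Kbar
  subst hgen
  have hinv : ∀ (σ : Kbar ≃ₐ[K] Kbar) (x : Kbar), v (σ x) = v x := hens.algEquiv_eq
  obtain ⟨c, hc0, hc⟩ := hpure.exists_best hdefectless
  let α : K⟮a⟯ := ⟨a, IntermediateField.mem_adjoin_simple_self K a⟩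
  let β : K⟮a⟯ := α - algebraMap K K⟮a⟯ c
  have hlift : ∀ (σ : K⟮a⟯ ≃ₐ[K] K⟮a⟯) (x : K⟮a⟯), σ.liftNormal Kbar (x : Kbar) = (σ x : Kbar) :=
    fun σ => AlgEquiv.liftNormal_commutes σ Kbar
  have hRam := HenselRam.ram_encard_eq (v := v) (E := K⟮a⟯) (a := α) (b := β)
    (fun σ x => by rw [← hlift, hinv])
    (fun h => hc0 (congrArg Subtype.val h))
    (fun σ => by simp [β])
    (fun σ z hz => by
      have h := HenselRam.map_algEquiv_div_sub_one_le hinv hc hc0 (σ.liftNormal Kbar) z.2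
        (by simpa using hz)
      rw [hlift] at h
      rw [show σ.liftNormal Kbar a = (σ α : Kbar) from hlift σ α] at h
      push_cast
      exact h)
  refine ⟨?_, fun hwild => ?_⟩
  · rw [hRam, ← HenselRam.conjValues_eq (F := ↥(K⟮a⟯ ⊓ HenselRam.absRamField K v)) α fun σ => by
      rw [← HenselRam.fixing_inf_absRamField_iff hinv σ]
      exact Subtype.forall]
  · rw [hRam, ← HenselRam.conjValues_eq (F := K) α fun σ =>
      ⟨fun _ z hz hz0 => hwild.map_sub_lt hinv σ hz hz0, fun _ x => σ.commutes x⟩]
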